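/- Let $\mathcal{A}$ be a real central hyperplane arrangement, that is, a finite set of linear hyperplanes in a finite-dimensional real vector space $V$. Its faces are the strata of $V$ under the equivalence relation that identifies two points when, for each $H\in\mathcal{A}$, either both lie on $H$ or both lie strictly on the same side of $H$; its chambers $\mathrm{Ch}(\mathcal{A})$ are the faces contained in the complement of all the hyperplanes. The codimension of a face is that of its linear span, and $\mathcal{A}_F=\{H\in\mathcal{A}\mid F\subseteq H\}$. The rank of $\mathcal{A}$ is the codimension of $\bigcap_{H\in\mathcal{A}}H$. The tope graph of $\mathcal{A}$ has vertex set $\mathrm{Ch}(\mathcal{A})$, two chambers being adjacent if exactly one hyperplane of $\mathcal{A}$ separates them. The magnitude $\mathrm{Mag}(\mathcal{A})\in\mathbb{Q}(q)$ is the sum of all entries of the inverse of the matrix $[q^{d(C,D)}]_{C,D\in\mathrm{Ch}(\mathcal{A})}$, where $d$ is the shortest-path distance in the tope graph (the convention being $q^\infty=0$). Theorem. Let $\mathcal{A}$ have rank $3$ and let $n=\#\mathcal{A}$. For $k\ge 2$ let $n_k$ be the number of faces $F$ of $\mathcal{A}$ of codimension $2$ with $\#\mathcal{A}_F=k$ (so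 $n_k=0$ for $k>n$). Then, in $\mathbb{Q}(q)$, \[ \mathrm{Mag}(\mathcal{A})=\frac{1}{1+q^n}\left(\#\mathrm{Ch}(\mathcal{A})-\sum_{k\ge 2}\frac{2k\,n_k\,q\,(1-q^{k-1})}{(1+q)(1-q^k)}\right). \] -/

import Mathlib

/-- A real central hyperplane arrangement: a finite set of linear hyperplanes (linear subspaces of
codimension one) of a real vector space `V`. -/
structure HyperplaneArrangement (V : Type*) [AddCommGroup V] [Module ℝ V] where
  /-- The set of hyperplanes. -/
  hyperplanes : Finset (Submodule ℝ V)
  /-- Each member is a linear subspace of codimension one. -/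
  codim_eq_one : ∀ H ∈ hyperplanes, Module.finrank ℝ (V ⧸ H) = 1

namespace HyperplaneArrangement

variable {V : Type*} [AddCommGroup V] [Module ℝ V]

/-- The center: the intersection of all hyperplanes (all of `V` for the empty arrangement). -/
def center (A : HyperplaneArrangement V) : Submodule ℝ V :=
  ⨅ H ∈ A.hyperplanes, H

/-- The rank: the codimension of the center. -/
noncomputable def rank (A : HyperplaneArrangement V) : ℕ :=
  Module.finrank ℝ (V ⧸ A.center)

/-- Two points have the same position with respect to the hyperplane `H`: both lie on `H`, or
both lie in the same open half-space, i.e. the segment joining them does not meet `H`. -/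
def SamePosition (H : Submodule ℝ V) (x y : V) : Prop :=
  (x ∈ H ∧ y ∈ H) ∨ Disjoint (segment ℝ x y) (H : Set V)

/-- The stratum of `x`: all points in the same position as `x` with respect to every hyperplane. -/
def stratum (A : HyperplaneArrangement V) (x : V) : Set V :=
  {y | ∀ H ∈ A.hyperplanes, SamePosition H x y}

/-- The faces of the arrangement are the strata, as subsets of `V`. -/
def faces (A : HyperplaneArrangement V) : Set (Set V) :=
  Set.range A.stratum

/-- The chambers are the faces that lie in the complement of the union of the hyperplanes. -/
def chambers (A : HyperplaneArrangement V) : Set (Set V) :=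
  {C | C ∈ A.faces ∧ ∀ H ∈ A.hyperplanes, Disjoint C (H : Set V)}

/-- The codimension of a face, i.e. of its support, the smallest linear subspace containing it. -/
noncomputable def faceCodim (F : Set V) : ℕ :=
  Module.finrank ℝ (V ⧸ Submodule.span ℝ F)

/-- `A_F`: the hyperplanes of the arrangement that contain `F`. -/
noncomputable def containing (A : HyperplaneArrangement V) (F : Set V) :
    Finset (Submodule ℝ V) :=
  open Classical in A.hyperplanes.filter fun H => F ⊆ (H : Set V)

/-- `n_k`: the number of faces `F` of codimension `2` with exactly `k` hyperplanes containing `F`. -/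
noncomputable def numCodimTwo (A : HyperplaneArrangement V) (k : ℕ) : ℕ :=
  {F : Set V | F ∈ A.faces ∧ faceCodim F = 2 ∧ (A.containing F).card = k}.ncard

/-- `S(C, C')`: the hyperplanes of the arrangement that separate `C` from `C'`. -/
noncomputable def separating (A : HyperplaneArrangement V) (C C' : Set V) :
    Finset (Submodule ℝ V) :=
  open Classical in A.hyperplanes.filter fun H =>
    ∀ x ∈ C, ∀ y ∈ C', (segment ℝ x y ∩ (H : Set V)).Nonempty

theorem separating_comm (A : HyperplaneArrangement V) (C C' : Set V) :
    A.separating C C' = A.separating C' C := by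
  classical
  ext H
  simp only [separating, Finset.mem_filter]
  constructor
  · rintro ⟨hH, h⟩
    exact ⟨hH, fun x hx y hy => segment_symm ℝ y x ▸ h y hy x hx⟩
  · rintro ⟨hH, h⟩
    exact ⟨hH, fun x hx y hy => segment_symm ℝ y x ▸ h y hy x hx⟩

theorem mem_stratum_self (A : HyperplaneArrangement V) (x : V) : x ∈ A.stratum x := by
  intro H _
  by_cases hx : x ∈ H
  · exact Or.inl ⟨hx, hx⟩
  · right
    rw [segment_same]
    simpa using hx

theorem separating_self (A : HyperplaneArrangement V) {C : Set V} (hC : C ∈ A.chambers) :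
    A.separating C C = ∅ := by
  classical
  obtain ⟨⟨x, rfl⟩, hd⟩ := hC
  simp only [separating, Finset.filter_eq_empty_iff]
  intro H hH h
  have hx := A.mem_stratum_self x
  obtain ⟨z, hz, hzH⟩ := h x hx x hx
  rw [segment_same, Set.mem_singleton_iff] at hz
  subst hz
  exact Set.disjoint_left.mp (hd H hH) hx hzH

/-- The tope graph: its vertices are the chambers, and two chambers are adjacent when exactly one
hyperplane separates them. -/
def topeGraph (A : HyperplaneArrangement V) : SimpleGraph A.chambers where
  Adj C C' := (A.separating C.1 C'.1).card = 1
  symm := ⟨fun C C' h => by rw [separating_comm]; exact h⟩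
  loopless := ⟨fun C h => by simp [A.separating_self C.2] at h⟩

theorem exists_mem_segment_map_eq_zero (f : V →ₗ[ℝ] ℝ) {x y : V} (hx : f x < 0)
    (hy : 0 < f y) : ∃ z ∈ segment ℝ x y, f z = 0 := by
  have hd : 0 < f y - f x := by linarith
  refine ⟨(f y / (f y - f x)) • x + (-f x / (f y - f x)) • y,
    ⟨_, _, by positivity, div_nonneg (by linarith) hd.le, ?_, rfl⟩, ?_⟩
  · field_simp
    ring
  · simp only [map_add, map_smul, smul_eq_mul]
    field_simp
    ring

/-- The position with respect to a hyperplane is the sign of a defining form. -/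
theorem samePosition_ker_iff (f : V →ₗ[ℝ] ℝ) {x y : V} :
    SamePosition (LinearMap.ker f) x y ↔ SignType.sign (f x) = SignType.sign (f y) := by
  constructor
  · rintro (⟨hx, hy⟩ | h)
    · rw [LinearMap.mem_ker] at hx hy
      rw [hx, hy]
    · have key : ∀ z ∈ segment ℝ x y, f z ≠ 0 := fun z hz hz0 =>
        Set.disjoint_left.mp h hz hz0
      rcases lt_or_gt_of_ne (key x (left_mem_segment ℝ x y)) with hx | hx <;>
        rcases lt_or_gt_of_ne (key y (right_mem_segment ℝ x y)) with hy | hy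
      · rw [sign_neg hx, sign_neg hy]
      · obtain ⟨z, hz, hz0⟩ := exists_mem_segment_map_eq_zero f hx hy
        exact absurd hz0 (key z hz)
      · obtain ⟨z, hz, hz0⟩ := exists_mem_segment_map_eq_zero f hy hx
        exact absurd hz0 (key z (segment_symm ℝ y x ▸ hz))
      · rw [sign_pos hx, sign_pos hy]
  · intro h
    by_cases hx : f x = 0
    · left
      rw [hx, sign_zero] at h
      exact ⟨hx, sign_eq_zero_iff.mp h.symm⟩
    · right
      rw [Set.disjoint_left]
      rintro z ⟨a, b, ha, hb, hab, rfl⟩ hz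
      have hz' : a * f x + b * f y = 0 := by simpa using hz
      rcases lt_or_gt_of_ne hx with hx | hx
      · have hy : f y < 0 := by
          rw [sign_neg hx] at h
          exact sign_eq_neg_one_iff.mp h.symm
        have h1 := mul_nonpos_of_nonneg_of_nonpos ha hx.le
        have h2 := mul_nonpos_of_nonneg_of_nonpos hb hy.le
        have ha0 : a = 0 := (mul_eq_zero.mp (by linarith : a * f x = 0)).resolve_right hx.ne
        have hb0 : b = 0 := (mul_eq_zero.mp (by linarith : b * f y = 0)).resolve_right hy.ne
        linarith
      · have hy : 0 < f y := by
          rw [sign_pos hx] at h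
          exact sign_eq_one_iff.mp h.symm
        have h1 := mul_nonneg ha hx.le
        have h2 := mul_nonneg hb hy.le
        have ha0 : a = 0 := (mul_eq_zero.mp (by linarith : a * f x = 0)).resolve_right hx.ne'
        have hb0 : b = 0 := (mul_eq_zero.mp (by linarith : b * f y = 0)).resolve_right hy.ne'
        linarith

/-- Every hyperplane is the kernel of a linear form. -/
theorem exists_form (A : HyperplaneArrangement V) (H : A.hyperplanes) :
    ∃ f : V →ₗ[ℝ] ℝ, LinearMap.ker f = H.1 := by
  have h := A.codim_eq_one H.1 H.2
  have : Module.Finite ℝ (V ⧸ H.1) := Module.finite_of_finrank_pos (by omega)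
  have e : (V ⧸ H.1) ≃ₗ[ℝ] ℝ := LinearEquiv.ofFinrankEq _ _ (by simp [h])
  exact ⟨e.toLinearMap ∘ₗ H.1.mkQ, by rw [LinearEquiv.ker_comp, Submodule.ker_mkQ]⟩

/-- There are finitely many faces. -/
theorem finite_faces (A : HyperplaneArrangement V) : A.faces.Finite := by
  choose f hf using A.exists_form
  let P : (A.hyperplanes → SignType) → Set V :=
    fun s => {y | ∀ H, s H = SignType.sign (f H y)}
  refine (Set.finite_range P).subset ?_
  rintro _ ⟨x, rfl⟩
  refine ⟨fun H => SignType.sign (f H x), ?_⟩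
  ext y
  constructor
  · intro hy H hH
    have := (samePosition_ker_iff (f ⟨H, hH⟩)).mpr (hy ⟨H, hH⟩)
    rwa [hf] at this
  · intro hy H
    have := hy H.1 H.2
    rw [← hf H] at this
    exact (samePosition_ker_iff (f H)).mp this

noncomputable instance fintypeChambers (A : HyperplaneArrangement V) : Fintype A.chambers :=
  (A.finite_faces.subset fun _ hC => hC.1).fintype

end HyperplaneArrangement

/-- The zeta matrix `[q ^ d(x, y)]` of a finite graph over the field `ℚ(q)` of rational functions,
where `q ^ ∞ = 0` for vertices in different components. -/
noncomputable def graphZetaMatrix {W : Type*} (G : SimpleGraph W) : Matrix W W (RatFunc ℚ) :=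
  open Classical in
  Matrix.of fun x y => if G.Reachable x y then RatFunc.X ^ G.dist x y else 0

/-- The magnitude of a finite graph: the sum of all entries of the inverse of its zeta matrix.
(The zeta matrix is always invertible, as its determinant is a polynomial in `q` with constant
term `1`.) -/
noncomputable def graphMagnitude {W : Type*} [Fintype W] (G : SimpleGraph W) : RatFunc ℚ :=
  open Classical in
  ∑ x, ∑ y, (graphZetaMatrix G)⁻¹ x y

/-- The magnitude of an arrangement is the magnitude of its tope graph. -/
noncomputable def HyperplaneArrangement.magnitude {V : Type*} [AddCommGroup V] [Module ℝ V]
    (A : HyperplaneArrangement V) : RatFunc ℚ :=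
  graphMagnitude A.topeGraph

/-! Choose a defining form for each hyperplane. Faces become realized sign vectors (covectors), and
distances between chambers become numbers of opposite signs (`topeGraph_dist`). For a cell σ, let
g_σ be the vector indexed by chambers γ with entry q^{number of signs of σ opposite to γ}. If σ is a
chamber, g_σ is a column of the zeta matrix; for σ = 0 it is the constant vector 1.

The engine is a weighted Euler relation (`sum_cellStar_pow_opposite`): the sum of (-1)^{codim τ} g_τ
over the cells τ having σ in their closure equals q^{#A_σ} g_σ. It follows from the unweighted Euler
relation for convex regions (`sum_neg_one_pow_codim`) by expanding q^m = ((q-1)+1)^m.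

Let μ(v) be the sum of the entries of Z⁻¹v, where Z is the zeta matrix. Then μ is 1 on each column
and μ(1) is the magnitude, so applying μ to the relations determines it recursively
(`map_one_of_map_chamber`). Codimension 1 gives 2 - μ = qμ, so μ = 2/(1+q). A cell of codimension 2
in k hyperplanes has 2k chambers and 2k walls around it, so μ(1 - q^k) = 2k(2/(1+q) - 1). The origin
expresses (1+q^n) times the magnitude through the chambers, the walls and the codimension 2 cells;
the number of walls is eliminated by `card_edges`. -/

/-! ### Sign vectors of points for a family of linear forms. -/

section SignVectors

variable {V ι : Type*} [AddCommGroup V] [Module ℝ V] (f : ι → V →ₗ[ℝ] ℝ)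

/-- The sign vector of a point with respect to a family of linear forms. -/
noncomputable def signVector (x : V) : ι → SignType := fun i => SignType.sign (f i x)

theorem signVector_neg (x : V) (i : ι) : signVector f (-x) i = -signVector f x i := by
  simp [signVector, Left.sign_neg]

theorem signVector_zero (i : ι) : signVector f 0 i = 0 := by
  simp [signVector]

theorem signVector_eq_zero {x : V} {i : ι} : signVector f x i = 0 ↔ f i x = 0 := by
  simp [signVector, sign_eq_zero_iff]

/-- Moving slightly from `x` in direction `v` changes only the vanishing signs. -/
theorem exists_pos_signVector_add_smul [Finite ι] (x v : V) :
    ∃ t : ℝ, 0 < t ∧ ∀ i,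
      (signVector f x i ≠ 0 → signVector f (x + t • v) i = signVector f x i) ∧
      (signVector f x i = 0 → signVector f (x + t • v) i = signVector f v i) := by
  -- Each coordinate condition holds for all small t > 0; there are finitely many coordinates, so
  -- one t serves them all.
  have key : ∀ i, ∀ᶠ t : ℝ in nhdsWithin 0 (Set.Ioi 0),
      (signVector f x i ≠ 0 → signVector f (x + t • v) i = signVector f x i) ∧
      (signVector f x i = 0 → signVector f (x + t • v) i = signVector f v i) := by
    intro i
    have hc : Filter.Tendsto (fun t : ℝ => f i x + t * f i v) (nhdsWithin 0 (Set.Ioi 0))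
        (nhds (f i x)) := by
      have : Continuous (fun t : ℝ => f i x + t * f i v) := by fun_prop
      simpa using (this.tendsto 0).mono_left nhdsWithin_le_nhds
    rcases lt_trichotomy (f i x) 0 with h | h | h
    · filter_upwards [hc.eventually (gt_mem_nhds h)] with t ht
      simp [signVector, sign_neg ht, sign_neg h]
    · filter_upwards [self_mem_nhdsWithin] with t ht
      simp only [signVector, map_add, map_smul, smul_eq_mul, h, zero_add, sign_zero, ne_eq,
        not_true_eq_false, false_imp_iff, true_and, forall_const]
      rw [sign_mul, sign_pos ht, one_mul]
    · filter_upwards [hc.eventually (lt_mem_nhds h)] with t ht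
      simp [signVector, sign_pos ht, sign_pos h]
  obtain ⟨t, ht, ht0⟩ := ((Filter.eventually_all.mpr key).and self_mem_nhdsWithin).exists
  exact ⟨t, ht0, ht⟩

/-- Covectors are closed under the composition of oriented matroid theory. -/
theorem exists_signVector_comp [Finite ι] (x v : V) :
    ∃ z, ∀ i, (signVector f x i ≠ 0 → signVector f z i = signVector f x i) ∧
      (signVector f x i = 0 → signVector f z i = signVector f v i) :=
  let ⟨t, _, ht⟩ := exists_pos_signVector_add_smul f x v
  ⟨x + t • v, ht⟩

/-- Two points on different sides of a form `a` have between them a point on its kernel. -/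
theorem exists_form_eq_zero_between {x y : V} {a : ι} (hx : signVector f x a ≠ 0)
    (hxy : signVector f y a = -signVector f x a) :
    ∃ z, f a z = 0 ∧ ∀ i, signVector f x i = signVector f y i →
      signVector f z i = signVector f x i := by
  have hx' : f a x ≠ 0 := fun h => hx ((signVector_eq_zero f).2 h)
  have hy' : f a y ≠ 0 := fun h => hx (by
    rw [(signVector_eq_zero f).2 h] at hxy
    simpa using hxy.symm)
  -- The weights cancel the two opposite values of `f a`. They need not sum to one, since positive
  -- scaling preserves signs.
  refine ⟨|f a y| • x + |f a x| • y, ?_, fun i hi => ?_⟩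
  · simp only [map_add, map_smul, smul_eq_mul]
    simp only [signVector] at hxy
    rcases lt_or_gt_of_ne hx' with h1 | h1 <;> rcases lt_or_gt_of_ne hy' with h2 | h2
    · rw [sign_neg h1, sign_neg h2] at hxy
      exact absurd hxy (by decide)
    · rw [abs_of_neg h1, abs_of_pos h2]
      ring
    · rw [abs_of_pos h1, abs_of_neg h2]
      ring
    · rw [sign_pos h1, sign_pos h2] at hxy
      exact absurd hxy (by decide)
  · simp only [signVector, map_add, map_smul, smul_eq_mul] at hi ⊢
    have p1 := abs_pos.2 hx'
    have p2 := abs_pos.2 hy'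
    rcases lt_trichotomy (f i x) 0 with h | h | h
    · rw [sign_neg h] at hi ⊢
      have := sign_eq_neg_one_iff.1 hi.symm
      exact sign_neg (by nlinarith [mul_pos p2 (neg_pos.2 h), mul_pos p1 (neg_pos.2 this)])
    · rw [h, sign_zero] at hi
      rw [h, sign_eq_zero_iff.1 hi.symm]
      simp
    · rw [sign_pos h] at hi ⊢
      have := sign_eq_one_iff.1 hi.symm
      exact sign_pos (by positivity)

/-! ### Codimension of intersections of kernels. -/

/-- The common kernel of the forms indexed by `Z`. -/
def commonKer (Z : Finset ι) : Submodule ℝ V := ⨅ i ∈ Z, LinearMap.ker (f i)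

theorem mem_commonKer {Z : Finset ι} {x : V} : x ∈ commonKer f Z ↔ ∀ i ∈ Z, f i x = 0 := by
  simp [commonKer, Submodule.mem_iInf]

/-- The codimension of the common kernel of the forms indexed by `Z`. -/
noncomputable def kerCodim (Z : Finset ι) : ℕ := Module.finrank ℝ (V ⧸ commonKer f Z)

theorem kerCodim_empty : kerCodim f ∅ = 0 := by
  have h : commonKer f ∅ = ⊤ := by simp [commonKer]
  rw [kerCodim, h]
  exact Module.finrank_zero_of_subsingleton

theorem commonKer_insert [DecidableEq ι] (a : ι) (Z : Finset ι) :
    commonKer f (insert a Z) = commonKer f Z ⊓ LinearMap.ker (f a) := by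
  rw [commonKer, Finset.iInf_insert, inf_comm]
  rfl

theorem kerCodim_insert_of_le [DecidableEq ι] {a : ι} {Z : Finset ι} (h : commonKer f Z ≤ LinearMap.ker (f a)) :
    kerCodim f (insert a Z) = kerCodim f Z := by
  rw [kerCodim, commonKer_insert, inf_eq_left.2 h, kerCodim]

section FiniteDimensional

variable [FiniteDimensional ℝ V]

theorem finrank_quotient_inf_ker {W : Submodule ℝ V} {g : V →ₗ[ℝ] ℝ}
    (h : ¬ W ≤ LinearMap.ker g) :
    Module.finrank ℝ (V ⧸ (W ⊓ LinearMap.ker g : Submodule ℝ V)) =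
      Module.finrank ℝ (V ⧸ W) + 1 := by
  have h1 := W.finrank_quotient_add_finrank
  have h2 := (W ⊓ LinearMap.ker g).finrank_quotient_add_finrank
  have hne : g.domRestrict W ≠ 0 := by
    intro h0
    exact h fun x hx => by simpa using LinearMap.congr_fun h0 ⟨x, hx⟩
  have h3 := Module.Dual.finrank_ker_add_one_of_ne_zero (f := g.domRestrict W) hne
  have h4 : Module.finrank ℝ (LinearMap.ker (g.domRestrict W)) =
      Module.finrank ℝ (W ⊓ LinearMap.ker g : Submodule ℝ V) := by
    rw [LinearMap.ker_domRestrict, ← Submodule.finrank_map_subtype_eq,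
      Submodule.map_comap_subtype]
  omega

theorem kerCodim_mono {Z Z' : Finset ι} (h : Z ⊆ Z') : kerCodim f Z ≤ kerCodim f Z' := by
  have hle : commonKer f Z' ≤ commonKer f Z := fun x hx =>
    (mem_commonKer f).2 fun i hi => (mem_commonKer f).1 hx i (h hi)
  have h1 := (commonKer f Z).finrank_quotient_add_finrank
  have h2 := (commonKer f Z').finrank_quotient_add_finrank
  have h3 := Submodule.finrank_mono hle
  unfold kerCodim
  omega

theorem commonKer_eq_of_kerCodim_eq {Z Z' : Finset ι} (h : Z ⊆ Z')
    (hc : kerCodim f Z = kerCodim f Z') : commonKer f Z' = commonKer f Z := by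
  have hle : commonKer f Z' ≤ commonKer f Z := fun x hx =>
    (mem_commonKer f).2 fun i hi => (mem_commonKer f).1 hx i (h hi)
  have h1 := (commonKer f Z).finrank_quotient_add_finrank
  have h2 := (commonKer f Z').finrank_quotient_add_finrank
  unfold kerCodim at hc
  exact Submodule.eq_of_le_of_finrank_eq hle (by omega)

variable [DecidableEq ι]

theorem kerCodim_insert {a : ι} {Z : Finset ι} (h : ¬ commonKer f Z ≤ LinearMap.ker (f a)) :
    kerCodim f (insert a Z) = kerCodim f Z + 1 := by
  rw [kerCodim, commonKer_insert, finrank_quotient_inf_ker h, kerCodim]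

theorem kerCodim_singleton {i : ι} (hi : f i ≠ 0) : kerCodim f {i} = 1 := by
  have := kerCodim_insert f (a := i) (Z := ∅) (by
    intro h
    apply hi
    ext x
    exact h ((mem_commonKer f).2 (by simp)))
  simpa [kerCodim_empty] using this

end FiniteDimensional

/-- The indices at which a sign vector vanishes. -/
def zeroSet [Fintype ι] (σ : ι → SignType) : Finset ι := Finset.univ.filter fun i => σ i = 0

theorem mem_zeroSet [Fintype ι] {σ : ι → SignType} {i : ι} : i ∈ zeroSet σ ↔ σ i = 0 := by
  simp [zeroSet]

/-! ### The Euler relation for regions cut out by sign conditions. -/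

section Covectors

variable [Fintype ι] [DecidableEq ι]

open Classical in
/-- The realized sign vectors. -/
noncomputable def covectors : Finset (ι → SignType) :=
  Finset.univ.filter fun σ => ∃ x, signVector f x = σ

theorem mem_covectors {σ : ι → SignType} : σ ∈ covectors f ↔ ∃ x, signVector f x = σ := by
  simp [covectors]

/-- The codimension of the cell of a sign vector. -/
noncomputable def codim (σ : ι → SignType) : ℕ := kerCodim f (zeroSet σ)

variable [FiniteDimensional ℝ V]

/-- The Euler relation: the alternating number of cells inside a cell of a subfamily. -/
theorem sum_neg_one_pow_codim (B : Finset ι) (x : V) :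
    ∑ σ ∈ (covectors f).filter (fun σ => ∀ i ∈ B, σ i = signVector f x i), (-1 : ℤ) ^ codim f σ =
      (-1) ^ kerCodim f (B.filter fun i => f i x = 0) := by
  -- Sign conditions are imposed one form at a time, until the region is a single cell.
  induction hn : Bᶜ.card generalizing B x with
  | zero =>
    have hB : B = Finset.univ := by simpa using hn
    subst hB
    have : (covectors f).filter (fun σ => ∀ i ∈ Finset.univ, σ i = signVector f x i) =
        {signVector f x} := by
      ext σ
      simp only [Finset.mem_filter, mem_covectors, Finset.mem_univ, forall_const,
        Finset.mem_singleton]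
      exact ⟨fun h => funext h.2, fun h => ⟨⟨x, h.symm⟩, fun i => h ▸ rfl⟩⟩
    rw [this, Finset.sum_singleton, codim, zeroSet]
    simp only [signVector_eq_zero]
  | succ m ih =>
    obtain ⟨a, ha⟩ : Bᶜ.Nonempty := Finset.card_pos.1 (by omega)
    have haB : a ∉ B := by simpa using ha
    have hcard : (insert a B)ᶜ.card = m := by
      rw [Finset.compl_insert, Finset.card_erase_of_mem ha]
      omega
    set Z := B.filter fun i => f i x = 0 with hZ
    -- The region is split by the sign of the new form `f a`; `h v` is the contribution of the piece
    -- with sign `v`, and the induction hypothesis evaluates each nonempty piece.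
    set h : SignType → ℤ := fun v => ∑ σ ∈ (covectors f).filter
      (fun σ => (∀ i ∈ B, σ i = signVector f x i) ∧ σ a = v), (-1 : ℤ) ^ codim f σ with hh
    have hsum : ∑ σ ∈ (covectors f).filter (fun σ => ∀ i ∈ B, σ i = signVector f x i),
        (-1 : ℤ) ^ codim f σ = ∑ v, h v := by
      rw [← Finset.sum_fiberwise _ (fun σ => σ a)]
      simp only [hh, Finset.filter_filter]
    have hval : ∀ y, (∀ i ∈ B, signVector f y i = signVector f x i) →
        h (signVector f y a) =
          (-1) ^ kerCodim f ((insert a B).filter fun i => f i y = 0) := by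
      intro y hy
      rw [← ih (insert a B) y hcard]
      simp only [hh]
      congr 1
      ext σ
      simp only [Finset.mem_filter, Finset.forall_mem_insert]
      constructor
      · rintro ⟨h1, h2, h3⟩
        exact ⟨h1, h3, fun i hi => (h2 i hi).trans (hy i hi).symm⟩
      · rintro ⟨h1, h2, h3⟩
        exact ⟨h1, fun i hi => (h3 i hi).trans (hy i hi), h2⟩
    have hfil : ∀ y, (∀ i ∈ B, signVector f y i = signVector f x i) →
        B.filter (fun i => f i y = 0) = Z := by
      intro y hy
      refine Finset.filter_congr fun i hi => ?_
      rw [← signVector_eq_zero f, hy i hi, signVector_eq_zero]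
    have hval0 : ∀ y, (∀ i ∈ B, signVector f y i = signVector f x i) → f a y = 0 →
        h 0 = (-1) ^ kerCodim f (insert a Z) := by
      intro y hy hay
      rw [← (signVector_eq_zero f).2 hay, hval y hy, Finset.filter_insert, if_pos hay, hfil y hy]
    have hval1 : ∀ y, (∀ i ∈ B, signVector f y i = signVector f x i) → f a y ≠ 0 →
        h (signVector f y a) = (-1) ^ kerCodim f Z := by
      intro y hy hay
      rw [hval y hy, Finset.filter_insert, if_neg hay, hfil y hy]
    have hnone : ∀ v, (∀ y, (∀ i ∈ B, signVector f y i = signVector f x i) →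
        signVector f y a ≠ v) → h v = 0 := by
      intro v hv
      refine Finset.sum_eq_zero fun σ hσ => ?_
      simp only [Finset.mem_filter, mem_covectors] at hσ
      obtain ⟨⟨y, rfl⟩, h1, h2⟩ := hσ
      exact absurd h2 (hv y h1)
    have huniv : ∀ v : SignType, v ≠ 0 → ∑ v, h v = h 0 + h v + h (-v) := by
      intro v hv
      have : (Finset.univ : Finset SignType) = {0, 1, -1} := by decide
      rw [this, Finset.sum_insert (by decide), Finset.sum_insert (by decide),
        Finset.sum_singleton]
      fin_cases v
      · exact absurd rfl hv
      · change _ = h 0 + h (-1) + h 1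
        ring
      · change _ = h 0 + h 1 + h (-1)
        ring
    have hmem : ∀ y, (∀ i ∈ B, signVector f y i = signVector f x i) → y ∈ commonKer f Z := by
      intro y hy
      refine (mem_commonKer f).2 fun i hi => ?_
      rw [← hfil y hy] at hi
      exact (Finset.mem_filter.1 hi).2
    rw [hsum]
    -- With c the codimension of the common kernel of `Z`: if the kernel of `f a` contains that
    -- common kernel, only sign 0 occurs and c is unchanged. If it cuts the region properly, all
    -- three signs occur and (-1)^(c+1) + 2(-1)^c = (-1)^c. If it misses the region, convexity
    -- leaves a single nonzero sign.
    by_cases hex : ∃ y, (∀ i ∈ B, signVector f y i = signVector f x i) ∧ f a y = 0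
    · obtain ⟨y, hy, hay⟩ := hex
      by_cases hle : commonKer f Z ≤ LinearMap.ker (f a)
      · have hz : ∀ v, v ≠ 0 → h v = 0 := fun v hv => hnone v fun y hy h0 => hv (by
          rw [← h0]
          exact (signVector_eq_zero f).2 (hle (hmem y hy)))
        rw [huniv 1 (by decide), hz 1 (by decide), hz (-1) (by decide), hval0 y hy hay,
          kerCodim_insert_of_le f hle]
        ring
      · obtain ⟨v, hvZ, hva⟩ := Set.not_subset.1 hle
        have hva' : f a v ≠ 0 := hva
        have hyZ := hfil y hy
        -- A small move from `y` along `w` stays in the region, because `w` kills the forms that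
        -- vanish on it, and leaves the kernel of `f a` on the side of `w`.
        have main : ∀ w ∈ commonKer f Z, f a w ≠ 0 →
            h (signVector f w a) = (-1) ^ kerCodim f Z := by
          intro w hw hwa
          obtain ⟨z, hz⟩ := exists_signVector_comp f y w
          have hza : signVector f z a = signVector f w a :=
            (hz a).2 ((signVector_eq_zero f).2 hay)
          rw [← hza]
          refine hval1 z (fun i hi => ?_) ?_
          · by_cases h0 : signVector f y i = 0
            · rw [(hz i).2 h0, ← hy i hi, h0, signVector_eq_zero]
              refine (mem_commonKer f).1 hw i ?_
              rw [← hyZ]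
              exact Finset.mem_filter.2 ⟨hi, (signVector_eq_zero f).1 h0⟩
            · rw [(hz i).1 h0, hy i hi]
          · rwa [Ne, ← signVector_eq_zero f, hza, signVector_eq_zero]
        have h1 := main v hvZ hva'
        have h2 := main (-v) (neg_mem hvZ) (by simpa using hva')
        rw [signVector_neg] at h2
        rw [huniv (signVector f v a) (by rwa [Ne, signVector_eq_zero]), h1, h2,
          hval0 y hy hay, kerCodim_insert f hle, pow_succ]
        ring
    · push Not at hex
      have hx := hex x fun _ _ => rfl
      have hx' : signVector f x a ≠ 0 := by rwa [Ne, signVector_eq_zero]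
      have h0 : h 0 = 0 := hnone 0 fun y hy hy0 => hex y hy ((signVector_eq_zero f).1 hy0)
      have h2 : h (-signVector f x a) = 0 := hnone _ fun y hy hya => by
        obtain ⟨z, hz, hz'⟩ := exists_form_eq_zero_between f hx' hya
        exact hex z (fun i hi => hz' i (hy i hi).symm) hz
      rw [huniv _ hx', h0, h2, hval1 x (fun _ _ => rfl) hx]
      ring

end Covectors

end SignVectors

/-! ### Stars of cells and the weighted Euler relation. -/

section Cells

variable {V ι : Type*} [AddCommGroup V] [Module ℝ V] (f : ι → V →ₗ[ℝ] ℝ)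
variable [Fintype ι]

theorem zeroSet_zero : zeroSet (0 : ι → SignType) = Finset.univ := by
  simp [zeroSet]

theorem sum_card_zeroSet (S : Finset (ι → SignType)) :
    ∑ σ ∈ S, (zeroSet σ).card = ∑ i, (S.filter fun σ => σ i = 0).card := by
  simp only [zeroSet, Finset.card_filter]
  exact Finset.sum_comm

theorem sum_neg_one_pow_codim_mul {R : Type*} [CommRing R] (S : Finset (ι → SignType)) (d : ℕ)
    (hS : ∀ σ ∈ S, codim f σ ≤ d) (g : (ι → SignType) → R) :
    ∑ σ ∈ S, (-1) ^ codim f σ * g σ =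
      ∑ k ∈ Finset.range (d + 1), (-1) ^ k * ∑ σ ∈ S.filter (fun σ => codim f σ = k), g σ := by
  rw [← Finset.sum_fiberwise_of_maps_to (t := Finset.range (d + 1)) (g := codim f)
    (fun σ hσ => Finset.mem_range.2 (Nat.lt_succ_of_le (hS σ hσ)))]
  refine Finset.sum_congr rfl fun k _ => ?_
  rw [Finset.mul_sum]
  refine Finset.sum_congr rfl fun σ hσ => ?_
  rw [(Finset.mem_filter.1 hσ).2]

theorem alternating_card (S : Finset (ι → SignType)) (d : ℕ) (hS : ∀ σ ∈ S, codim f σ ≤ d) :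
    ∑ σ ∈ S, (-1 : ℤ) ^ codim f σ =
      ∑ k ∈ Finset.range (d + 1), (-1) ^ k * ((S.filter fun σ => codim f σ = k).card : ℤ) := by
  have := sum_neg_one_pow_codim_mul f S d hS (fun _ => (1 : ℤ))
  simpa using this

theorem codim_zero_eq : codim f 0 = kerCodim f Finset.univ := by
  rw [codim, zeroSet_zero]

variable [DecidableEq ι]

/-- The number of positions at which two sign vectors are opposite. -/
def opposite (σ τ : ι → SignType) : ℕ := (Finset.univ.filter fun i => τ i = -σ i).card

/-- The covectors of codimension `k`. -/
noncomputable def cells (k : ℕ) : Finset (ι → SignType) :=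
  (covectors f).filter fun σ => codim f σ = k

/-- The covectors whose cell has the cell of `σ` in its closure. -/
noncomputable def cellStar (σ : ι → SignType) : Finset (ι → SignType) :=
  (covectors f).filter fun τ => ∀ i, σ i ≠ 0 → τ i = σ i

theorem mem_cells {k : ℕ} {σ : ι → SignType} :
    σ ∈ cells f k ↔ σ ∈ covectors f ∧ codim f σ = k := by
  simp [cells]

theorem mem_cellStar {σ τ : ι → SignType} :
    τ ∈ cellStar f σ ↔ τ ∈ covectors f ∧ ∀ i, σ i ≠ 0 → τ i = σ i := by
  simp [cellStar]

theorem self_mem_cellStar {σ : ι → SignType} (hσ : σ ∈ covectors f) : σ ∈ cellStar f σ :=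
  (mem_cellStar f).2 ⟨hσ, fun _ _ => rfl⟩

theorem zero_mem_covectors : (0 : ι → SignType) ∈ covectors f :=
  (mem_covectors f).2 ⟨0, funext fun i => signVector_zero f i⟩

theorem cellStar_zero : cellStar f 0 = covectors f := by
  simp [cellStar]

theorem zeroSet_subset_of_mem_cellStar {σ τ : ι → SignType} (h : τ ∈ cellStar f σ) :
    zeroSet τ ⊆ zeroSet σ := by
  intro i hi
  rw [mem_zeroSet] at hi ⊢
  by_contra h0
  exact h0 (((mem_cellStar f).1 h).2 i h0 ▸ hi)

variable [FiniteDimensional ℝ V]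

theorem codim_le_of_mem_cellStar {σ τ : ι → SignType} (h : τ ∈ cellStar f σ) :
    codim f τ ≤ codim f σ :=
  kerCodim_mono f (zeroSet_subset_of_mem_cellStar f h)

/-- Equal codimension makes the two common kernels coincide, so every form vanishing on the smaller
cell already vanishes on the larger one. -/
theorem eq_of_mem_cellStar {σ τ : ι → SignType} (h : τ ∈ cellStar f σ)
    (hc : codim f τ = codim f σ) : τ = σ := by
  have hk := commonKer_eq_of_kerCodim_eq f (zeroSet_subset_of_mem_cellStar f h) hc
  obtain ⟨⟨y, rfl⟩, h2⟩ := (mem_cellStar f).1 h |>.imp_left (mem_covectors f).1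
  have hy : y ∈ commonKer f (zeroSet (signVector f y)) := (mem_commonKer f).2 fun i hi =>
    (signVector_eq_zero f).1 (mem_zeroSet.1 hi)
  rw [← hk] at hy
  funext i
  by_cases h0 : σ i = 0
  · rw [h0, signVector_eq_zero]
    exact (mem_commonKer f).1 hy i (mem_zeroSet.2 h0)
  · exact h2 i h0

theorem filter_cellStar_codim {σ : ι → SignType} (hσ : σ ∈ covectors f) :
    (cellStar f σ).filter (fun τ => codim f τ = codim f σ) = {σ} := by
  ext τ
  rw [Finset.mem_filter, Finset.mem_singleton]
  constructor
  · exact fun h => eq_of_mem_cellStar f h.1 h.2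
  · rintro rfl
    exact ⟨self_mem_cellStar f hσ, rfl⟩

/-- The Euler relation in the star of a cell, weighted by the distance to a fixed chamber. -/
theorem sum_cellStar_pow_opposite {R : Type*} [CommRing R] (q : R) {σ γ : ι → SignType}
    (hσ : σ ∈ covectors f) (hγ : γ ∈ covectors f) (hγ0 : ∀ i, γ i ≠ 0) :
    ∑ τ ∈ cellStar f σ, (-1) ^ codim f τ * q ^ opposite γ τ =
      q ^ (zeroSet σ).card * q ^ opposite γ σ := by
  -- Signs off the zero set of `σ` are frozen in the star, so only coordinates in `zeroSet σ` add to
  -- the exponent. The binomial expansion of ((q-1)+1)^m runs over the sets `T` of such coordinates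
  -- where `τ` is opposite to `γ`.
  have hopp : ∀ τ ∈ cellStar f σ, q ^ opposite γ τ = q ^ opposite γ σ *
      ∑ T ∈ (zeroSet σ).powerset, if ∀ i ∈ T, τ i = -γ i then (q - 1) ^ T.card else 0 := by
    intro τ hτ
    have h1 : opposite γ τ = opposite γ σ + ((zeroSet σ).filter fun i => τ i = -γ i).card := by
      unfold opposite
      rw [← Finset.card_union_of_disjoint]
      · congr 1
        ext i
        simp only [Finset.mem_filter, Finset.mem_univ, true_and, Finset.mem_union, mem_zeroSet]
        by_cases h0 : σ i = 0
        · have : (0 : SignType) ≠ -γ i := by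
            have := hγ0 i
            revert this
            cases γ i <;> decide
          simp [h0, this]
        · simp [h0, ((mem_cellStar f).1 hτ).2 i h0]
      · rw [Finset.disjoint_left]
        intro i h1 h2
        simp only [Finset.mem_filter, Finset.mem_univ, true_and, mem_zeroSet] at h1 h2
        rw [h2.1] at h1
        have := hγ0 i
        revert this h1
        cases γ i <;> decide
    rw [h1, pow_add, ← Finset.sum_filter]
    congr 1
    have h2 : (zeroSet σ).powerset.filter (fun T => ∀ i ∈ T, τ i = -γ i) =
        ((zeroSet σ).filter fun i => τ i = -γ i).powerset := by
      ext T
      simp only [Finset.mem_filter, Finset.mem_powerset, Finset.subset_iff]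
      exact ⟨fun h i hi => ⟨h.1 hi, h.2 i hi⟩, fun h => ⟨fun i hi => (h hi).1, fun i hi => (h hi).2⟩⟩
    rw [h2]
    have := Finset.sum_pow_mul_eq_add_pow (q - 1) 1 ((zeroSet σ).filter fun i => τ i = -γ i)
    simpa using this.symm
  have hinner : ∀ T ∈ (zeroSet σ).powerset,
      ∑ τ ∈ (cellStar f σ).filter (fun τ => ∀ i ∈ T, τ i = -γ i), (-1 : R) ^ codim f τ = 1 := by
    intro T hT
    rw [Finset.mem_powerset] at hT
    obtain ⟨x, rfl⟩ := (mem_covectors f).1 hσ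
    obtain ⟨y, rfl⟩ := (mem_covectors f).1 hγ
    -- Perturbing a point of `σ` away from the chamber `γ` gives a point satisfying all the
    -- prescribed signs, whatever `T` is. None of these signs is zero, so the region is open and its
    -- Euler sum is 1.
    obtain ⟨z, hz⟩ := exists_signVector_comp f x (-y)
    have hzT : ∀ i ∈ T, signVector f z i = -signVector f y i := fun i hi => by
      rw [(hz i).2 (mem_zeroSet.1 (hT hi)), signVector_neg]
    have := sum_neg_one_pow_codim f ((zeroSet (signVector f x))ᶜ ∪ T) z
    have hemp : ((zeroSet (signVector f x))ᶜ ∪ T).filter (fun i => f i z = 0) = ∅ := by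
      refine Finset.filter_false_of_mem fun i hi h0 => ?_
      rw [← signVector_eq_zero f] at h0
      rcases Finset.mem_union.1 hi with h | h
      · have h1 : signVector f x i ≠ 0 := by simpa [mem_zeroSet] using h
        exact h1 ((hz i).1 h1 ▸ h0)
      · rw [hzT i h] at h0
        have := hγ0 i
        revert this h0
        cases signVector f y i <;> decide
    rw [hemp, kerCodim_empty, pow_zero] at this
    have hcast := congrArg (Int.cast : ℤ → R) this
    push_cast at hcast
    refine Eq.trans (Finset.sum_congr ?_ fun _ _ => rfl) hcast
    ext τ
    simp only [Finset.mem_filter, mem_cellStar, Finset.mem_union, Finset.mem_compl, mem_zeroSet]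
    constructor
    · rintro ⟨⟨h1, h2⟩, h3⟩
      refine ⟨h1, fun i hi => ?_⟩
      rcases hi with h | h
      · rw [h2 i h, (hz i).1 h]
      · rw [h3 i h, hzT i h]
    · rintro ⟨h1, h2⟩
      exact ⟨⟨h1, fun i hi => (h2 i (Or.inl hi)).trans ((hz i).1 hi)⟩,
        fun i hi => (h2 i (Or.inr hi)).trans (hzT i hi)⟩
  calc ∑ τ ∈ cellStar f σ, (-1) ^ codim f τ * q ^ opposite γ τ
      = ∑ τ ∈ cellStar f σ, ∑ T ∈ (zeroSet σ).powerset, q ^ opposite γ σ *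
          ((q - 1) ^ T.card * if ∀ i ∈ T, τ i = -γ i then (-1) ^ codim f τ else 0) := by
        refine Finset.sum_congr rfl fun τ hτ => ?_
        rw [hopp τ hτ, Finset.mul_sum, Finset.mul_sum]
        refine Finset.sum_congr rfl fun T _ => ?_
        split_ifs <;> ring
    _ = ∑ T ∈ (zeroSet σ).powerset, q ^ opposite γ σ * (q - 1) ^ T.card := by
        rw [Finset.sum_comm]
        refine Finset.sum_congr rfl fun T hT => ?_
        rw [← Finset.mul_sum, ← Finset.mul_sum, ← Finset.sum_filter, hinner T hT, mul_one]
    _ = q ^ (zeroSet σ).card * q ^ opposite γ σ := by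
        rw [← Finset.mul_sum, mul_comm]
        congr 1
        have := Finset.sum_pow_mul_eq_add_pow (q - 1) 1 (zeroSet σ)
        simpa using this

/-- The alternating number of cells in a star is one. -/
theorem sum_cellStar {σ : ι → SignType} (hσ : σ ∈ covectors f) :
    ∑ τ ∈ cellStar f σ, (-1 : ℤ) ^ codim f τ = 1 := by
  obtain ⟨x, rfl⟩ := (mem_covectors f).1 hσ
  have := sum_neg_one_pow_codim f (zeroSet (signVector f x))ᶜ x
  have hemp : (zeroSet (signVector f x))ᶜ.filter (fun i => f i x = 0) = ∅ := by
    ext i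
    simp [mem_zeroSet, signVector_eq_zero]
  rw [hemp, kerCodim_empty, pow_zero] at this
  refine Eq.trans (Finset.sum_congr ?_ fun _ _ => rfl) this
  ext τ
  simp [mem_cellStar, mem_zeroSet]

/-- The star meets the kernel of `f i` in a nonempty relatively open subset of a hyperplane, whence
the sign of codimension one. -/
theorem sum_cellStar_wall (hf : ∀ i, f i ≠ 0) {σ : ι → SignType} (hσ : σ ∈ covectors f) {i : ι}
    (hi : σ i = 0) :
    ∑ τ ∈ (cellStar f σ).filter (fun τ => τ i = 0), (-1 : ℤ) ^ codim f τ = -1 := by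
  obtain ⟨x, rfl⟩ := (mem_covectors f).1 hσ
  have := sum_neg_one_pow_codim f (insert i (zeroSet (signVector f x))ᶜ) x
  have hemp : (insert i (zeroSet (signVector f x))ᶜ).filter (fun i => f i x = 0) = {i} := by
    ext j
    simp only [Finset.mem_filter, Finset.mem_insert, Finset.mem_compl, mem_zeroSet,
      signVector_eq_zero, Finset.mem_singleton]
    constructor
    · rintro ⟨h | h, h0⟩
      · exact h
      · exact absurd h0 h
    · rintro rfl
      exact ⟨Or.inl rfl, (signVector_eq_zero f).1 hi⟩
  rw [hemp, kerCodim_singleton f (hf i), pow_one] at this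
  refine Eq.trans (Finset.sum_congr ?_ fun _ _ => rfl) this
  ext τ
  simp only [Finset.mem_filter, mem_cellStar, Finset.forall_mem_insert, Finset.mem_compl,
    mem_zeroSet, hi]
  tauto

theorem codim_pos (hf : ∀ i, f i ≠ 0) {σ : ι → SignType} {i : ι} (hi : σ i = 0) :
    1 ≤ codim f σ := by
  rw [← kerCodim_singleton f (hf i)]
  exact kerCodim_mono f (by simpa [mem_zeroSet] using hi)

theorem codim_eq_zero_iff (hf : ∀ i, f i ≠ 0) {σ : ι → SignType} :
    codim f σ = 0 ↔ ∀ i, σ i ≠ 0 := by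
  constructor
  · intro h i hi
    have := codim_pos f hf hi
    omega
  · intro h
    have : zeroSet σ = ∅ := by
      ext i
      simp [mem_zeroSet, h i]
    rw [codim, this, kerCodim_empty]

theorem two_le_codim (hf : ∀ i, f i ≠ 0)
    (hind : ∀ i j, i ≠ j → ¬ LinearMap.ker (f i) ≤ LinearMap.ker (f j))
    {σ : ι → SignType} (h : 1 < (zeroSet σ).card) : 2 ≤ codim f σ := by
  obtain ⟨i, hi, j, hj, hij⟩ := Finset.one_lt_card.1 h
  have h2 : kerCodim f {j, i} = 2 := by
    rw [kerCodim_insert, kerCodim_singleton f (hf i)]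
    simpa [commonKer] using hind i j hij
  rw [← h2]
  exact kerCodim_mono f (by simp [Finset.insert_subset_iff, hi, hj])

theorem card_zeroSet_of_codim_one (hf : ∀ i, f i ≠ 0)
    (hind : ∀ i j, i ≠ j → ¬ LinearMap.ker (f i) ≤ LinearMap.ker (f j))
    {σ : ι → SignType} (h : codim f σ = 1) : (zeroSet σ).card = 1 := by
  have h1 : (zeroSet σ).card ≤ 1 := by
    by_contra hc
    have := two_le_codim f hf hind (σ := σ) (by omega)
    omega
  have h2 : (zeroSet σ).card ≠ 0 := by
    intro h0
    rw [Finset.card_eq_zero] at h0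
    rw [codim, h0, kerCodim_empty] at h
    omega
  omega

theorem two_le_card_zeroSet (hf : ∀ i, f i ≠ 0) {σ : ι → SignType} (h : codim f σ = 2) :
    2 ≤ (zeroSet σ).card := by
  by_contra hc
  have h1 : (zeroSet σ).card ≤ 1 := by omega
  rcases Nat.le_one_iff_eq_zero_or_eq_one.1 h1 with h0 | h0
  · rw [Finset.card_eq_zero] at h0
    rw [codim, h0, kerCodim_empty] at h
    omega
  · obtain ⟨i, hi⟩ := Finset.card_eq_one.1 h0
    rw [codim, hi, kerCodim_singleton f (hf i)] at h
    omega

/-! ### Counting chambers and walls around a cell. -/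

/-- With c₀ chambers in the star, the Euler relation reads c₀ - 1 = 1. -/
theorem card_chambers_star_of_codim_one {σ : ι → SignType} (hσ : σ ∈ covectors f)
    (h : codim f σ = 1) : ((cellStar f σ).filter fun τ => codim f τ = 0).card = 2 := by
  have h1 := sum_cellStar f hσ
  have h2 := filter_cellStar_codim f hσ
  rw [alternating_card f _ 1 (fun τ hτ => h ▸ codim_le_of_mem_cellStar f hτ)] at h1
  rw [h] at h2
  simp only [Finset.sum_range_succ, Finset.sum_range_zero, h2, Finset.card_singleton] at h1
  push_cast at h1
  omega

/-- The Euler relation reads c₀ - c₁ + 1 = 1. -/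
theorem card_chambers_star_of_codim_two {σ : ι → SignType} (hσ : σ ∈ covectors f)
    (h : codim f σ = 2) : ((cellStar f σ).filter fun τ => codim f τ = 0).card =
      ((cellStar f σ).filter fun τ => codim f τ = 1).card := by
  have h1 := sum_cellStar f hσ
  have h2 := filter_cellStar_codim f hσ
  rw [alternating_card f _ 2 (fun τ hτ => h ▸ codim_le_of_mem_cellStar f hτ)] at h1
  rw [h] at h2
  simp only [Finset.sum_range_succ, Finset.sum_range_zero, h2, Finset.card_singleton] at h1
  push_cast at h1
  omega

theorem filter_wall_codim_zero (hf : ∀ i, f i ≠ 0) (S : Finset (ι → SignType)) (i : ι) :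
    (S.filter fun τ => τ i = 0).filter (fun τ => codim f τ = 0) = ∅ := by
  refine Finset.filter_false_of_mem fun τ hτ h0 => ?_
  exact (codim_eq_zero_iff f hf).1 h0 i (Finset.mem_filter.1 hτ).2

/-- Each codimension 1 cell lies in exactly one hyperplane, so the count splits by hyperplanes. In a
hyperplane through `σ` the wall relation reads -c₁ + 1 = -1, so it carries two such cells. -/
theorem card_edges_star_of_codim_two (hf : ∀ i, f i ≠ 0)
    (hind : ∀ i j, i ≠ j → ¬ LinearMap.ker (f i) ≤ LinearMap.ker (f j))
    {σ : ι → SignType} (hσ : σ ∈ covectors f) (h : codim f σ = 2) :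
    ((cellStar f σ).filter fun τ => codim f τ = 1).card = 2 * (zeroSet σ).card := by
  have h1 : ((cellStar f σ).filter fun τ => codim f τ = 1).card =
      ∑ τ ∈ (cellStar f σ).filter fun τ => codim f τ = 1, (zeroSet τ).card := by
    rw [Finset.card_eq_sum_ones]
    exact Finset.sum_congr rfl fun τ hτ =>
      (card_zeroSet_of_codim_one f hf hind (Finset.mem_filter.1 hτ).2).symm
  rw [h1, sum_card_zeroSet]
  have h2 : ∀ i, (((cellStar f σ).filter fun τ => codim f τ = 1).filter fun τ => τ i = 0).card =
      if σ i = 0 then 2 else 0 := by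
    intro i
    split_ifs with hi
    · have e := sum_cellStar_wall f hf hσ hi
      rw [alternating_card f _ 2 (fun τ hτ =>
        h ▸ codim_le_of_mem_cellStar f (Finset.mem_filter.1 hτ).1)] at e
      have e2 : ((cellStar f σ).filter fun τ => τ i = 0).filter (fun τ => codim f τ = 2) = {σ} := by
        rw [Finset.filter_comm, ← h, filter_cellStar_codim f hσ, Finset.filter_singleton, if_pos hi]
      simp only [Finset.sum_range_succ, Finset.sum_range_zero, e2, Finset.card_singleton,
        filter_wall_codim_zero f hf, Finset.card_empty] at e
      rw [Finset.filter_comm]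
      push_cast at e
      omega
    · rw [Finset.card_eq_zero]
      refine Finset.filter_false_of_mem fun τ hτ h0 => hi ?_
      by_contra hne
      exact hne (((mem_cellStar f).1 (Finset.mem_filter.1 hτ).1).2 i hne ▸ h0)
  simp only [h2]
  rw [← Finset.sum_filter, Finset.sum_const, smul_eq_mul, mul_comm]
  rfl

theorem filter_covectors_codim_three (h3 : kerCodim f Finset.univ = 3) :
    (covectors f).filter (fun τ => codim f τ = 3) = {0} := by
  have := filter_cellStar_codim f (zero_mem_covectors f)
  rwa [cellStar_zero, codim_zero_eq, h3] at this

theorem codim_le_three (h3 : kerCodim f Finset.univ = 3) {σ : ι → SignType}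
    (hσ : σ ∈ covectors f) : codim f σ ≤ 3 := by
  rw [← h3, ← codim_zero_eq]
  exact codim_le_of_mem_cellStar f (by rwa [cellStar_zero])

/-- Each restriction to a hyperplane has as many edges as vertices. -/
theorem card_edges (hf : ∀ i, f i ≠ 0)
    (hind : ∀ i j, i ≠ j → ¬ LinearMap.ker (f i) ≤ LinearMap.ker (f j))
    (h3 : kerCodim f Finset.univ = 3) :
    (cells f 1).card = ∑ σ ∈ cells f 2, (zeroSet σ).card := by
  have h1 : (cells f 1).card = ∑ τ ∈ cells f 1, (zeroSet τ).card := by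
    rw [Finset.card_eq_sum_ones]
    exact Finset.sum_congr rfl fun τ hτ =>
      (card_zeroSet_of_codim_one f hf hind (Finset.mem_filter.1 hτ).2).symm
  rw [h1, sum_card_zeroSet, sum_card_zeroSet]
  refine Finset.sum_congr rfl fun i _ => ?_
  -- Within one hyperplane having e cells of codimension 1 and v of codimension 2, the wall relation
  -- at the origin reads -e + v - 1 = -1.
  have e := sum_cellStar_wall f hf (zero_mem_covectors f) (i := i) rfl
  rw [cellStar_zero, alternating_card f _ 3 (fun τ hτ =>
    codim_le_three f h3 (Finset.mem_filter.1 hτ).1)] at e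
  have e3 : ((covectors f).filter fun τ => τ i = 0).filter (fun τ => codim f τ = 3) = {0} := by
    rw [Finset.filter_comm, filter_covectors_codim_three f h3, Finset.filter_singleton]
    simp
  simp only [Finset.sum_range_succ, Finset.sum_range_zero, e3, Finset.card_singleton,
    filter_wall_codim_zero f hf, Finset.card_empty] at e
  rw [cells, cells, Finset.filter_comm, Finset.filter_comm (p := fun σ => codim f σ = 2)]
  push_cast at e
  omega

/-- A linear functional taking the value one on every column of the distance matrix of the
chambers is determined on the constant function by the cells of codimension two. -/
theorem map_one_of_map_chamber {K X : Type*} [Field K] {q : K} (hq : ∀ k, 0 < k → q ^ k ≠ 1)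
    (hq1 : 1 + q ≠ 0) (hf : ∀ i, f i ≠ 0)
    (hind : ∀ i j, i ≠ j → ¬ LinearMap.ker (f i) ≤ LinearMap.ker (f j))
    (h3 : kerCodim f Finset.univ = 3) (c : X → ι → SignType) (hc : ∀ x, c x ∈ cells f 0)
    (μ : (X → K) →ₗ[K] K)
    (hμ : ∀ σ ∈ cells f 0, μ (fun x => q ^ opposite (c x) σ) = 1) :
    (1 + q ^ Fintype.card ι) * μ 1 = (cells f 0).card - ∑ σ ∈ cells f 2,
      2 * ((zeroSet σ).card : K) * q * (1 - q ^ ((zeroSet σ).card - 1)) /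
        ((1 + q) * (1 - q ^ (zeroSet σ).card)) := by
  set g : (ι → SignType) → X → K := fun σ x => q ^ opposite (c x) σ with hg
  -- The weighted Euler relation holds in every chamber coordinate, hence between the vectors `g τ`;
  -- `μ` is applied to it.
  have rel : ∀ σ ∈ covectors f,
      ∑ k ∈ Finset.range (codim f σ + 1),
        (-1) ^ k * ∑ τ ∈ (cellStar f σ).filter (fun τ => codim f τ = k), μ (g τ) =
      q ^ (zeroSet σ).card * μ (g σ) := by
    intro σ hσ
    rw [← sum_neg_one_pow_codim_mul f _ _ (fun τ hτ => codim_le_of_mem_cellStar f hτ)]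
    have : ∑ τ ∈ cellStar f σ, ((-1 : K) ^ codim f τ) • g τ = (q ^ (zeroSet σ).card) • g σ := by
      funext x
      have hx := (mem_cells f).1 (hc x)
      have := sum_cellStar_pow_opposite f q hσ hx.1 ((codim_eq_zero_iff f hf).1 hx.2)
      simpa [hg] using this
    have h := congrArg μ this
    simpa using h
  have hcham : ∀ σ ∈ covectors f, ∑ τ ∈ (cellStar f σ).filter (fun τ => codim f τ = 0), μ (g τ) =
      (((cellStar f σ).filter fun τ => codim f τ = 0).card : K) := by
    intro σ _
    rw [Finset.card_eq_sum_ones, Nat.cast_sum]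
    refine Finset.sum_congr rfl fun τ hτ => ?_
    obtain ⟨h1, h2⟩ := Finset.mem_filter.1 hτ
    rw [hμ τ ((mem_cells f).2 ⟨((mem_cellStar f).1 h1).1, h2⟩), Nat.cast_one]
  -- The relation is 2 - μ = qμ.
  have edge : ∀ σ ∈ covectors f, codim f σ = 1 → μ (g σ) = 2 / (1 + q) := by
    intro σ hσ h
    have r := rel σ hσ
    have e := filter_cellStar_codim f hσ
    rw [h] at r e
    simp only [Finset.sum_range_succ, Finset.sum_range_zero, e, Finset.sum_singleton,
      hcham σ hσ, card_chambers_star_of_codim_one f hσ h,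
      card_zeroSet_of_codim_one f hf hind h] at r
    rw [eq_div_iff hq1]
    push_cast at r
    linear_combination -r
  have hedge : ∀ σ ∈ covectors f, ∑ τ ∈ (cellStar f σ).filter (fun τ => codim f τ = 1), μ (g τ) =
      (((cellStar f σ).filter fun τ => codim f τ = 1).card : K) * (2 / (1 + q)) := by
    intro σ _
    rw [← nsmul_eq_mul, ← Finset.sum_const]
    refine Finset.sum_congr rfl fun τ hτ => ?_
    obtain ⟨h1, h2⟩ := Finset.mem_filter.1 hτ
    exact edge τ ((mem_cellStar f).1 h1).1 h2
  -- The subtracted term is the share of the walls charged to this cell: by `card_edges`, the walls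
  -- number as many as all pairs of a codimension 2 cell and a hyperplane through it.
  have vertex : ∀ σ ∈ cells f 2, μ (g σ) - (zeroSet σ).card * (2 / (1 + q)) =
      -(2 * ((zeroSet σ).card : K) * q * (1 - q ^ ((zeroSet σ).card - 1)) /
        ((1 + q) * (1 - q ^ (zeroSet σ).card))) := by
    intro σ hσ'
    obtain ⟨hσ, h⟩ := (mem_cells f).1 hσ'
    have r := rel σ hσ
    have e := filter_cellStar_codim f hσ
    rw [h] at r e
    simp only [Finset.sum_range_succ, Finset.sum_range_zero, e, Finset.sum_singleton,
      hcham σ hσ, hedge σ hσ, card_chambers_star_of_codim_two f hσ h,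
      card_edges_star_of_codim_two f hf hind hσ h] at r
    have h2 := two_le_card_zeroSet f hf h
    obtain ⟨m, hm⟩ : ∃ m, (zeroSet σ).card = m + 1 := ⟨(zeroSet σ).card - 1, by omega⟩
    rw [hm] at r ⊢
    have hne : 1 - q ^ (m + 1) ≠ 0 := sub_ne_zero.2 (hq (m + 1) (by omega)).symm
    have hval : μ (g σ) = 2 * ((m + 1 : ℕ) : K) * (2 / (1 + q) - 1) / (1 - q ^ (m + 1)) := by
      rw [eq_div_iff hne]
      push_cast at r ⊢
      linear_combination r
    rw [hval, Nat.add_sub_cancel]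
    field_simp
    ring
  have r := rel 0 (zero_mem_covectors f)
  -- A zero sign is never opposite to a sign of a chamber.
  have hg0 : g 0 = 1 := by
    funext x
    have hx := (codim_eq_zero_iff f hf).1 ((mem_cells f).1 (hc x)).2
    have : opposite (c x) 0 = 0 := by
      rw [opposite, Finset.card_eq_zero]
      refine Finset.filter_false_of_mem fun i _ h0 => hx i ?_
      revert h0
      rw [Pi.zero_apply]
      cases c x i <;> decide
    simp [hg, this]
  rw [codim_zero_eq, h3] at r
  have hE := hedge 0 (zero_mem_covectors f)
  have hC := hcham 0 (zero_mem_covectors f)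
  rw [cellStar_zero] at r hE hC
  simp only [Finset.sum_range_succ, Finset.sum_range_zero, filter_covectors_codim_three f h3,
    Finset.sum_singleton, hg0, zeroSet_zero, Finset.card_univ, hE, hC] at r
  change _ + _ * ((cells f 0).card : K) + _ * (((cells f 1).card : K) * _) +
    _ * (∑ σ ∈ cells f 2, μ (g σ)) + _ = _ at r
  have hV := Finset.sum_congr rfl vertex
  rw [Finset.sum_sub_distrib, ← Finset.sum_mul, Finset.sum_neg_distrib, ← Nat.cast_sum,
    ← card_edges f hf hind h3] at hV
  linear_combination -r + hV

end Cells

/-! ### Chambers lying between two given chambers. -/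

section Chambers

variable {V ι : Type*} [AddCommGroup V] [Module ℝ V] (f : ι → V →ₗ[ℝ] ℝ)

/-- A point `w` between `x` and `y` on the hyperplane of `i` is perturbed into a chamber. If `w` is
off the hyperplane of `j`, its side there decides whether to move towards `y` or `x`. If `w` lies on
both, a direction is needed that has the sign of `y` at `i` and of `x` at `j`; it exists because the
kernel of `f i` is not contained in that of `f j`. -/
theorem exists_signVector_intermediate [Finite ι] {x y : V} {i j : ι}
    (hij : ¬ LinearMap.ker (f i) ≤ LinearMap.ker (f j))
    (hx : ∀ k, signVector f x k ≠ 0) (hy : ∀ k, signVector f y k ≠ 0)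
    (hi : signVector f x i ≠ signVector f y i) (hj : signVector f x j ≠ signVector f y j) :
    ∃ z, (∀ k, signVector f z k ≠ 0) ∧
      (∀ k, signVector f x k = signVector f y k → signVector f z k = signVector f x k) ∧
      ((signVector f z i = signVector f y i ∧ signVector f z j = signVector f x j) ∨
        (signVector f z i = signVector f x i ∧ signVector f z j = signVector f y j)) := by
  have hneg : ∀ s t : SignType, s ≠ 0 → t ≠ 0 → s ≠ t → t = -s := by decide
  have hthree : ∀ s t r : SignType, s ≠ 0 → t ≠ 0 → s ≠ t → r ≠ 0 → r = s ∨ r = t := by decide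
  obtain ⟨w, hwi, hw⟩ := exists_form_eq_zero_between f (hx i) (hneg _ _ (hx i) (hy i) hi)
  rw [← signVector_eq_zero f] at hwi
  have comp : ∀ v, (∀ k, signVector f v k ≠ 0) → ∃ z, (∀ k, signVector f z k ≠ 0) ∧
      (∀ k, signVector f x k = signVector f y k → signVector f z k = signVector f x k) ∧
      signVector f z i = signVector f v i ∧
      (signVector f w j ≠ 0 → signVector f z j = signVector f w j) ∧
      (signVector f w j = 0 → signVector f z j = signVector f v j) := by
    intro v hv
    obtain ⟨z, hz⟩ := exists_signVector_comp f w v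
    refine ⟨z, fun k => ?_, fun k hk => ?_, (hz i).2 hwi, (hz j).1, (hz j).2⟩
    · by_cases h0 : signVector f w k = 0
      · rw [(hz k).2 h0]
        exact hv k
      · rwa [(hz k).1 h0]
    · rw [(hz k).1 (by rw [hw k hk]; exact hx k), hw k hk]
  by_cases h0 : signVector f w j = 0
  · obtain ⟨u, hui, huj⟩ : ∃ u, f i u = 0 ∧ signVector f u j = signVector f x j := by
      obtain ⟨u, hui, huj⟩ := Set.not_subset.1 hij
      have hui' : f i u = 0 := hui
      have huj' : signVector f u j ≠ 0 := by
        rw [Ne, signVector_eq_zero]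
        exact huj
      by_cases h : signVector f u j = signVector f x j
      · exact ⟨u, hui', h⟩
      · refine ⟨-u, by simp [hui'], ?_⟩
        rw [signVector_neg, hneg _ _ huj' (hx j) h]
    obtain ⟨v, hv⟩ := exists_signVector_comp f u y
    have hv0 : ∀ k, signVector f v k ≠ 0 := fun k => by
      by_cases h : signVector f u k = 0
      · rw [(hv k).2 h]
        exact hy k
      · rwa [(hv k).1 h]
    obtain ⟨z, hz0, hz, hzi, -, hzj⟩ := comp v hv0
    refine ⟨z, hz0, hz, Or.inl ⟨?_, ?_⟩⟩
    · rw [hzi, (hv i).2 ((signVector_eq_zero f).2 hui)]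
    · rw [hzj h0, (hv j).1 (by rw [huj]; exact hx j), huj]
  · rcases hthree _ _ _ (hx j) (hy j) hj h0 with h | h
    · obtain ⟨z, hz0, hz, hzi, hzj, -⟩ := comp y hy
      exact ⟨z, hz0, hz, Or.inl ⟨hzi, by rw [hzj h0, h]⟩⟩
    · obtain ⟨z, hz0, hz, hzi, hzj, -⟩ := comp x hx
      exact ⟨z, hz0, hz, Or.inr ⟨hzi, by rw [hzj h0, h]⟩⟩

variable [Fintype ι]

theorem opposite_eq_hammingDist {σ τ : ι → SignType} (hσ : ∀ i, σ i ≠ 0) (hτ : ∀ i, τ i ≠ 0) :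
    opposite σ τ = hammingDist σ τ := by
  have key : ∀ s t : SignType, s ≠ 0 → t ≠ 0 → (t = -s ↔ s ≠ t) := by decide
  unfold opposite hammingDist
  congr 1
  exact Finset.filter_congr fun i _ => key _ _ (hσ i) (hτ i)

/-- The intermediate chamber keeps every sign on which the ends agree and crosses exactly one of two
separating hyperplanes. The separating set is thus partitioned into two nonempty parts. -/
theorem exists_hammingDist_add (hind : ∀ i j, i ≠ j →
      ¬ LinearMap.ker (f i) ≤ LinearMap.ker (f j)) {x y : V}
    (hx : ∀ k, signVector f x k ≠ 0) (hy : ∀ k, signVector f y k ≠ 0)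
    (h : 1 < hammingDist (signVector f x) (signVector f y)) :
    ∃ z, (∀ k, signVector f z k ≠ 0) ∧
      0 < hammingDist (signVector f x) (signVector f z) ∧
      0 < hammingDist (signVector f z) (signVector f y) ∧
      hammingDist (signVector f x) (signVector f z) +
        hammingDist (signVector f z) (signVector f y) =
        hammingDist (signVector f x) (signVector f y) := by
  classical
  obtain ⟨i, hi, j, hj, hij⟩ := Finset.one_lt_card.1 h
  rw [Finset.mem_filter] at hi hj
  obtain ⟨z, hz0, hz, hor⟩ := exists_signVector_intermediate f (hind i j hij) hx hy hi.2 hj.2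
  refine ⟨z, hz0, hammingDist_pos.2 ?_, hammingDist_pos.2 ?_, ?_⟩
  · intro e
    rcases hor with ⟨h1, -⟩ | ⟨-, h1⟩
    · exact hi.2 (e ▸ h1)
    · exact hj.2 (e ▸ h1)
  · intro e
    rcases hor with ⟨-, h1⟩ | ⟨h1, -⟩
    · exact hj.2 (e ▸ h1).symm
    · exact hi.2 (e ▸ h1).symm
  · unfold hammingDist
    rw [← Finset.card_union_of_disjoint]
    · congr 1
      ext k
      simp only [Finset.mem_union, Finset.mem_filter, Finset.mem_univ, true_and]
      constructor
      · intro h1 e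
        have := hz k e
        rcases h1 with h1 | h1
        · exact h1 this.symm
        · exact h1 (this.trans e)
      · intro e
        by_contra hc
        push Not at hc
        exact e (hc.1.trans hc.2)
    · rw [Finset.disjoint_left]
      intro k h1 h2
      simp only [Finset.mem_filter, Finset.mem_univ, true_and] at h1 h2
      have key : ∀ s t r : SignType, s ≠ 0 → t ≠ 0 → r ≠ 0 → s ≠ r → r ≠ t → s = t := by decide
      exact h1 (hz k (key _ _ _ (hx k) (hy k) (hz0 k) h1 h2)).symm

end Chambers

/-! ### Translation of faces and separation into sign vectors. -/

namespace HyperplaneArrangement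

variable {V : Type*} [AddCommGroup V] [Module ℝ V] (A : HyperplaneArrangement V)

/-- A defining form of each hyperplane. -/
noncomputable def form (H : A.hyperplanes) : V →ₗ[ℝ] ℝ := (A.exists_form H).choose

theorem ker_form (H : A.hyperplanes) : LinearMap.ker (A.form H) = H.1 :=
  (A.exists_form H).choose_spec

theorem form_ne_zero (H : A.hyperplanes) : A.form H ≠ 0 := by
  intro h
  have h1 := A.codim_eq_one H.1 H.2
  rw [← A.ker_form H, h, LinearMap.ker_zero] at h1
  rw [Module.finrank_zero_of_subsingleton] at h1
  omega

theorem not_ker_form_le [FiniteDimensional ℝ V] (H H' : A.hyperplanes) (h : H ≠ H') :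
    ¬ LinearMap.ker (A.form H) ≤ LinearMap.ker (A.form H') := by
  intro hle
  rw [A.ker_form, A.ker_form] at hle
  have h1 := H.1.finrank_quotient_add_finrank
  have h2 := H'.1.finrank_quotient_add_finrank
  rw [A.codim_eq_one _ H.2] at h1
  rw [A.codim_eq_one _ H'.2] at h2
  exact h (Subtype.ext (Submodule.eq_of_le_of_finrank_eq hle (by omega)))

theorem kerCodim_form_univ : kerCodim A.form Finset.univ = A.rank := by
  have : commonKer A.form Finset.univ = A.center := by
    ext x
    simp only [mem_commonKer, center, Submodule.mem_iInf, Finset.mem_univ, forall_const,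
      ← LinearMap.mem_ker, ker_form, Subtype.forall]
  rw [kerCodim, this, rank]

theorem samePosition_iff (H : A.hyperplanes) {x y : V} :
    SamePosition H.1 x y ↔ signVector A.form x H = signVector A.form y H := by
  rw [← A.ker_form H]
  exact samePosition_ker_iff _

theorem mem_stratum {x y : V} :
    y ∈ A.stratum x ↔ signVector A.form y = signVector A.form x := by
  constructor
  · intro h
    funext H
    exact ((A.samePosition_iff H).1 (h H.1 H.2)).symm
  · intro h H hH
    exact (A.samePosition_iff ⟨H, hH⟩).2 (congrFun h _).symm

/-- The points with a given sign vector. -/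
def signCell (σ : A.hyperplanes → SignType) : Set V := {x | signVector A.form x = σ}

theorem mem_signCell {σ : A.hyperplanes → SignType} {x : V} :
    x ∈ A.signCell σ ↔ signVector A.form x = σ := Iff.rfl

theorem stratum_eq_signCell (x : V) : A.stratum x = A.signCell (signVector A.form x) :=
  Set.ext fun _ => A.mem_stratum

theorem mem_iff_signVector_eq_zero (H : A.hyperplanes) {x : V} :
    x ∈ H.1 ↔ signVector A.form x H = 0 := by
  rw [signVector_eq_zero, ← A.ker_form H, LinearMap.mem_ker]

theorem signCell_subset_iff (H : A.hyperplanes) (x : V) :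
    A.signCell (signVector A.form x) ⊆ (H.1 : Set V) ↔ signVector A.form x H = 0 := by
  constructor
  · intro h
    exact (A.mem_iff_signVector_eq_zero H).1 (h rfl)
  · intro h y hy
    refine (A.mem_iff_signVector_eq_zero H).2 ?_
    rwa [A.mem_signCell.1 hy]

theorem card_containing (x : V) :
    (A.containing (A.signCell (signVector A.form x))).card =
      (zeroSet (signVector A.form x)).card := by
  classical
  have : A.containing (A.signCell (signVector A.form x)) =
      (zeroSet (signVector A.form x)).map (Function.Embedding.subtype _) := by
    ext H
    simp only [containing, Finset.mem_filter, Finset.mem_map, mem_zeroSet,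
      Function.Embedding.coe_subtype, Subtype.exists, exists_and_right, exists_eq_right]
    constructor
    · rintro ⟨hH, h⟩
      exact ⟨hH, (A.signCell_subset_iff ⟨H, hH⟩ x).1 h⟩
    · rintro ⟨hH, h⟩
      exact ⟨hH, (A.signCell_subset_iff ⟨H, hH⟩ x).2 h⟩
  rw [this, Finset.card_map]

/-- A cell is relatively open in the common kernel: for v in that kernel and small t > 0, both x and
x + tv lie in the cell, so v is in the span. -/
theorem span_signCell (x : V) :
    Submodule.span ℝ (A.signCell (signVector A.form x)) =
      commonKer A.form (zeroSet (signVector A.form x)) := by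
  apply le_antisymm
  · rw [Submodule.span_le]
    intro y hy
    refine (mem_commonKer _).2 fun H hH => ?_
    rw [mem_zeroSet, ← A.mem_signCell.1 hy, signVector_eq_zero] at hH
    exact hH
  · intro v hv
    obtain ⟨t, ht, h⟩ := exists_pos_signVector_add_smul A.form x v
    have hx : x ∈ Submodule.span ℝ (A.signCell (signVector A.form x)) := Submodule.subset_span rfl
    have hz : x + t • v ∈ Submodule.span ℝ (A.signCell (signVector A.form x)) := by
      refine Submodule.subset_span (A.mem_signCell.2 (funext fun H => ?_))
      by_cases h0 : signVector A.form x H = 0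
      · rw [(h H).2 h0, h0, signVector_eq_zero]
        exact (mem_commonKer _).1 hv H (mem_zeroSet.2 h0)
      · exact (h H).1 h0
    have := Submodule.sub_mem _ hz hx
    rw [add_sub_cancel_left] at this
    exact (Submodule.smul_mem_iff _ ht.ne').1 this

theorem faceCodim_signCell (x : V) :
    faceCodim (A.signCell (signVector A.form x)) = codim A.form (signVector A.form x) := by
  rw [faceCodim, span_signCell, codim, kerCodim]

/-- Signs are constant on cells, so one pair of points decides for all. The hypothesis on `x` rules
out equal positions with both points on the hyperplane. -/
theorem mem_separating_iff {x y : V} (hx : ∀ H, signVector A.form x H ≠ 0)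
    (H : A.hyperplanes) :
    H.1 ∈ A.separating (A.signCell (signVector A.form x)) (A.signCell (signVector A.form y)) ↔
      signVector A.form x H ≠ signVector A.form y H := by
  simp only [separating, Finset.mem_filter, H.2, true_and, mem_signCell]
  constructor
  · intro h e
    obtain ⟨z, hz, hzH⟩ := h x rfl y rfl
    rcases (A.samePosition_iff H).2 e with h1 | h1
    · exact hx H ((A.mem_iff_signVector_eq_zero H).1 h1.1)
    · exact Set.disjoint_left.1 h1 hz hzH
  · intro h u hu v hv
    rw [← hu, ← hv, Ne, ← A.samePosition_iff H] at h
    rw [← Set.not_disjoint_iff_nonempty_inter]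
    exact fun hd => h (Or.inr hd)

theorem card_separating {x y : V} (hx : ∀ H, signVector A.form x H ≠ 0) :
    (A.separating (A.signCell (signVector A.form x)) (A.signCell (signVector A.form y))).card =
      hammingDist (signVector A.form x) (signVector A.form y) := by
  classical
  have : A.separating (A.signCell (signVector A.form x)) (A.signCell (signVector A.form y)) =
      (Finset.univ.filter fun H => signVector A.form x H ≠ signVector A.form y H).map
        (Function.Embedding.subtype _) := by
    ext H
    simp only [Finset.mem_filter, Finset.mem_univ, true_and, Finset.mem_map,
      Function.Embedding.coe_subtype, Subtype.exists, exists_and_right, exists_eq_right]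
    constructor
    · intro h
      have hH : H ∈ A.hyperplanes := (Finset.mem_filter.1 h).1
      exact ⟨hH, (A.mem_separating_iff hx ⟨H, hH⟩).1 h⟩
    · rintro ⟨hH, h⟩
      exact (A.mem_separating_iff hx ⟨H, hH⟩).2 h
  rw [this, Finset.card_map]
  rfl

theorem exists_chamber_point (C : A.chambers) :
    ∃ x, A.signCell (signVector A.form x) = C.1 ∧ ∀ H, signVector A.form x H ≠ 0 := by
  obtain ⟨C, ⟨x, rfl⟩, hC⟩ := C
  refine ⟨x, (A.stratum_eq_signCell x).symm, fun H h => ?_⟩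
  exact Set.disjoint_left.1 (hC H.1 H.2) (A.mem_stratum_self x)
    ((A.mem_iff_signVector_eq_zero H).2 h)

theorem signCell_mem_chambers {x : V} (hx : ∀ H, signVector A.form x H ≠ 0) :
    A.signCell (signVector A.form x) ∈ A.chambers := by
  refine ⟨⟨x, A.stratum_eq_signCell x⟩, fun H hH => Set.disjoint_left.2 fun y hy hyH => ?_⟩
  refine hx ⟨H, hH⟩ ?_
  rw [← A.mem_signCell.1 hy]
  exact (A.mem_iff_signVector_eq_zero ⟨H, hH⟩).1 hyH

/-- A point of a chamber. -/
noncomputable def chamberPoint (C : A.chambers) : V := (A.exists_chamber_point C).choose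

/-- The sign vector of a chamber. -/
noncomputable def chamberSign (C : A.chambers) : A.hyperplanes → SignType :=
  signVector A.form (A.chamberPoint C)

theorem signCell_chamberSign (C : A.chambers) : A.signCell (A.chamberSign C) = C.1 :=
  (A.exists_chamber_point C).choose_spec.1

theorem chamberSign_ne_zero (C : A.chambers) (H : A.hyperplanes) : A.chamberSign C H ≠ 0 :=
  (A.exists_chamber_point C).choose_spec.2 H

theorem chamberSign_injective : Function.Injective A.chamberSign := by
  intro C D h
  apply Subtype.ext
  rw [← A.signCell_chamberSign C, h, A.signCell_chamberSign]

theorem exists_chamberSign_eq {x : V} (hx : ∀ H, signVector A.form x H ≠ 0) :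
    ∃ C, A.chamberSign C = signVector A.form x := by
  refine ⟨⟨_, A.signCell_mem_chambers hx⟩, ?_⟩
  have h := A.signCell_chamberSign ⟨_, A.signCell_mem_chambers hx⟩
  have hx' : x ∈ A.signCell (signVector A.form x) := rfl
  exact (A.mem_signCell.1 (h.symm.subset hx')).symm

/-! ### Distance in the tope graph. -/

theorem topeGraph_adj (C D : A.chambers) :
    A.topeGraph.Adj C D ↔ hammingDist (A.chamberSign C) (A.chamberSign D) = 1 := by
  change (A.separating C.1 D.1).card = 1 ↔ _
  rw [← A.signCell_chamberSign C, ← A.signCell_chamberSign D, chamberSign, chamberSign,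
    A.card_separating (A.chamberSign_ne_zero C)]

/-- Two chambers at Hamming distance above one are joined through an intermediate chamber strictly
closer to both. -/
theorem exists_walk [FiniteDimensional ℝ V] (m : ℕ) (C D : A.chambers)
    (h : hammingDist (A.chamberSign C) (A.chamberSign D) = m) :
    ∃ p : A.topeGraph.Walk C D, p.length = m := by
  induction m using Nat.strong_induction_on generalizing C D with
  | _ m ih =>
    rcases Nat.lt_or_ge 1 m with h1 | h1
    · obtain ⟨z, hz, p1, p2, hadd⟩ := exists_hammingDist_add A.form A.not_ker_form_le
        (A.chamberSign_ne_zero C) (A.chamberSign_ne_zero D) (h.symm ▸ h1)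
      obtain ⟨E, hE⟩ := A.exists_chamberSign_eq hz
      change 0 < hammingDist (A.chamberSign C) _ at p1
      change 0 < hammingDist _ (A.chamberSign D) at p2
      change hammingDist (A.chamberSign C) _ + hammingDist _ (A.chamberSign D) =
        hammingDist (A.chamberSign C) (A.chamberSign D) at hadd
      rw [← hE] at p1 p2 hadd
      obtain ⟨p, hp⟩ := ih _ (by omega) C E rfl
      obtain ⟨r, hr⟩ := ih _ (by omega) E D rfl
      exact ⟨p.append r, by rw [SimpleGraph.Walk.length_append]; omega⟩
    · rcases Nat.le_one_iff_eq_zero_or_eq_one.1 h1 with rfl | rfl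
      · obtain rfl := A.chamberSign_injective (hammingDist_eq_zero.1 h)
        exact ⟨SimpleGraph.Walk.nil, rfl⟩
      · exact ⟨((A.topeGraph_adj C D).2 h).toWalk, rfl⟩

theorem hammingDist_le_length {C D : A.chambers} (p : A.topeGraph.Walk C D) :
    hammingDist (A.chamberSign C) (A.chamberSign D) ≤ p.length := by
  induction p with
  | nil => simp
  | @cons C E D h p ih =>
    have h1 := (A.topeGraph_adj C E).1 h
    have h2 := hammingDist_triangle (A.chamberSign C) (A.chamberSign E) (A.chamberSign D)
    rw [SimpleGraph.Walk.length_cons]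
    omega

theorem topeGraph_reachable [FiniteDimensional ℝ V] (C D : A.chambers) :
    A.topeGraph.Reachable C D :=
  let ⟨p, _⟩ := A.exists_walk _ C D rfl
  ⟨p⟩

/-- The distance in the tope graph is the number of separating hyperplanes. -/
theorem topeGraph_dist [FiniteDimensional ℝ V] (C D : A.chambers) :
    A.topeGraph.dist C D = hammingDist (A.chamberSign C) (A.chamberSign D) := by
  obtain ⟨p, hp⟩ := A.exists_walk _ C D rfl
  obtain ⟨r, hr⟩ := (A.topeGraph_reachable C D).exists_walk_length_eq_dist
  have h1 := A.hammingDist_le_length r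
  have h2 := SimpleGraph.dist_le p
  omega

/-! ### Counting faces as covectors. -/

section Counting

variable [DecidableEq A.hyperplanes]

theorem mem_faces_iff {F : Set V} :
    F ∈ A.faces ↔ ∃ σ ∈ covectors A.form, A.signCell σ = F := by
  simp only [faces, Set.mem_range, mem_covectors, stratum_eq_signCell]
  simp

theorem signCell_injOn : Set.InjOn A.signCell (covectors A.form) := by
  intro σ hσ τ _ h
  obtain ⟨x, rfl⟩ := (mem_covectors _).1 (Finset.mem_coe.1 hσ)
  have hx : x ∈ A.signCell (signVector A.form x) := rfl
  rw [h] at hx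
  exact hx

theorem numCodimTwo_eq (k : ℕ) :
    A.numCodimTwo k = ((cells A.form 2).filter fun σ => (zeroSet σ).card = k).card := by
  have : {F : Set V | F ∈ A.faces ∧ faceCodim F = 2 ∧ (A.containing F).card = k} =
      A.signCell '' ((cells A.form 2).filter fun σ => (zeroSet σ).card = k : Finset _) := by
    ext F
    simp only [Set.mem_ofPred_eq, mem_faces_iff, Set.mem_image, Finset.coe_filter, mem_cells]
    constructor
    · rintro ⟨⟨σ, hσ, rfl⟩, h1, h2⟩
      obtain ⟨x, rfl⟩ := (mem_covectors _).1 hσ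
      rw [faceCodim_signCell] at h1
      rw [card_containing] at h2
      exact ⟨_, ⟨⟨hσ, h1⟩, h2⟩, rfl⟩
    · rintro ⟨σ, ⟨⟨hσ, h1⟩, h2⟩, rfl⟩
      obtain ⟨x, rfl⟩ := (mem_covectors _).1 hσ
      refine ⟨⟨_, hσ, rfl⟩, ?_, ?_⟩
      · rwa [faceCodim_signCell]
      · rwa [card_containing]
  rw [numCodimTwo, this, Set.InjOn.ncard_image, Set.ncard_coe_finset]
  refine A.signCell_injOn.mono fun σ hσ => ?_
  exact ((mem_cells _).1 (Finset.mem_filter.1 (Finset.mem_coe.1 hσ)).1).1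

theorem chamberSign_mem_cells [FiniteDimensional ℝ V] (C : A.chambers) :
    A.chamberSign C ∈ cells A.form 0 :=
  (mem_cells _).2 ⟨(mem_covectors _).2 ⟨_, rfl⟩,
    (codim_eq_zero_iff _ A.form_ne_zero).2 (A.chamberSign_ne_zero C)⟩

theorem exists_chamberSign_of_mem_cells [FiniteDimensional ℝ V]
    {σ : A.hyperplanes → SignType} (hσ : σ ∈ cells A.form 0) : ∃ C, A.chamberSign C = σ := by
  obtain ⟨h1, h2⟩ := (mem_cells _).1 hσ
  obtain ⟨x, rfl⟩ := (mem_covectors _).1 h1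
  exact A.exists_chamberSign_eq ((codim_eq_zero_iff _ A.form_ne_zero).1 h2)

theorem ncard_chambers [FiniteDimensional ℝ V] : A.chambers.ncard = (cells A.form 0).card := by
  rw [← Nat.card_coe_set_eq, Nat.card_eq_fintype_card, ← Finset.card_univ]
  refine Finset.card_bij (fun C _ => A.chamberSign C) (fun C _ => A.chamberSign_mem_cells C)
    (fun C _ D _ h => A.chamberSign_injective h) fun σ hσ => ?_
  obtain ⟨C, hC⟩ := A.exists_chamberSign_of_mem_cells hσ
  exact ⟨C, Finset.mem_univ _, hC⟩

end Counting

end HyperplaneArrangement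

/-! ### The zeta matrix and the entry sum of its inverse. -/

section Magnitude

variable {W : Type*} [Fintype W]

open Classical in
/-- The determinant of the zeta matrix is a polynomial with constant term one. -/
theorem isUnit_det_graphZetaMatrix (G : SimpleGraph W) : IsUnit (graphZetaMatrix G).det := by
  set P : Matrix W W (Polynomial ℚ) := Matrix.of fun x y =>
    if G.Reachable x y then Polynomial.X ^ G.dist x y else 0 with hP
  have h1 : graphZetaMatrix G = (algebraMap (Polynomial ℚ) (RatFunc ℚ)).mapMatrix P := by
    ext x y
    simp only [graphZetaMatrix, hP, Matrix.of_apply, RingHom.mapMatrix_apply, Matrix.map_apply]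
    split_ifs <;> simp
  -- At q = 0 only the diagonal survives, since distinct reachable vertices have positive distance.
  have h2 : (Polynomial.evalRingHom (0 : ℚ)).mapMatrix P = 1 := by
    ext x y
    simp only [hP, Matrix.of_apply, RingHom.mapMatrix_apply, Matrix.map_apply,
      Polynomial.coe_evalRingHom, Matrix.one_apply]
    by_cases hxy : x = y
    · subst hxy
      simp
    · by_cases hr : G.Reachable x y
      · have := hr.pos_dist_of_ne hxy
        simp [hr, hxy, this.ne']
      · simp [hr, hxy]
  have h3 : P.det ≠ 0 := by
    intro h
    have := (Polynomial.evalRingHom (0 : ℚ)).map_det P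
    rw [h2, h, map_zero, Matrix.det_one] at this
    exact zero_ne_one this
  rw [isUnit_iff_ne_zero, h1, ← RingHom.map_det]
  exact (map_ne_zero_iff _ (RatFunc.algebraMap_injective ℚ)).2 h3

open Classical in
/-- The sum of the entries of the product of the inverse zeta matrix with a vector. -/
noncomputable def graphMass (G : SimpleGraph W) : (W → RatFunc ℚ) →ₗ[RatFunc ℚ] RatFunc ℚ :=
  (∑ x, LinearMap.proj x) ∘ₗ (graphZetaMatrix G)⁻¹.mulVecLin

theorem graphMass_one (G : SimpleGraph W) : graphMass G 1 = graphMagnitude G := by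
  simp [graphMass, graphMagnitude, Matrix.mulVec, dotProduct]

/-- The inverse matrix sends its column `y` to the basis vector at `y`, whose entries sum to one. -/
theorem graphMass_col (G : SimpleGraph W) (y : W) :
    graphMass G (fun x => graphZetaMatrix G x y) = 1 := by
  classical
  have h : (graphZetaMatrix G)⁻¹.mulVec (fun x => graphZetaMatrix G x y) = Pi.single y 1 := by
    have e : (fun x => graphZetaMatrix G x y) = (graphZetaMatrix G).mulVec (Pi.single y 1) := by
      rw [Matrix.mulVec_single_one]
      rfl
    rw [e, Matrix.mulVec_mulVec, Matrix.nonsing_inv_mul _ (by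
      convert isUnit_det_graphZetaMatrix G), Matrix.one_mulVec]
  have h' : graphMass G (fun x => graphZetaMatrix G x y) =
      ∑ z, (graphZetaMatrix G)⁻¹.mulVec (fun x => graphZetaMatrix G x y) z := by
    simp only [graphMass, LinearMap.comp_apply, LinearMap.sum_apply, LinearMap.proj_apply,
      Matrix.mulVecLin_apply]
  rw [h', h]
  simp

end Magnitude

/-- Comparison of degrees; the values c = 1 and c = -1 keep the denominators 1 - q^k and 1 + q^k
nonzero. -/
theorem RatFunc.X_pow_ne_C_of_pos {k : ℕ} (hk : 0 < k) (c : ℚ) :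
    (RatFunc.X : RatFunc ℚ) ^ k ≠ RatFunc.C c := by
  intro h
  rw [← RatFunc.algebraMap_X, ← map_pow, ← RatFunc.algebraMap_C] at h
  have := congrArg Polynomial.natDegree (RatFunc.algebraMap_injective ℚ h)
  rw [Polynomial.natDegree_X_pow, Polynomial.natDegree_C] at this
  omega

theorem RatFunc.one_add_X_pow_ne_zero (k : ℕ) : 1 + (RatFunc.X : RatFunc ℚ) ^ k ≠ 0 := by
  rcases Nat.eq_zero_or_pos k with rfl | hk
  · norm_num
  · intro h
    refine RatFunc.X_pow_ne_C_of_pos hk (-1) ?_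
    rw [map_neg, map_one]
    linear_combination h

theorem theorem4 {V : Type*} [AddCommGroup V] [Module ℝ V] [FiniteDimensional ℝ V]
    (A : HyperplaneArrangement V) (n : ℕ) (hrank : A.rank = 3) (hn : A.hyperplanes.card = n) :
    A.magnitude =
      1 / (1 + (RatFunc.X : RatFunc ℚ) ^ n) *
        ((A.chambers.ncard : RatFunc ℚ) -
          ∑ k ∈ Finset.Icc 2 n,
            2 * (k : RatFunc ℚ) * (A.numCodimTwo k : RatFunc ℚ) * RatFunc.X *
                (1 - RatFunc.X ^ (k - 1)) /
              ((1 + RatFunc.X) * (1 - RatFunc.X ^ k))) := by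
  classical
  have key := map_one_of_map_chamber A.form (q := (RatFunc.X : RatFunc ℚ))
    (fun k hk => by simpa using RatFunc.X_pow_ne_C_of_pos hk 1)
    (by simpa using RatFunc.one_add_X_pow_ne_zero 1) A.form_ne_zero A.not_ker_form_le
    (A.kerCodim_form_univ.trans hrank) A.chamberSign A.chamberSign_mem_cells
    (graphMass A.topeGraph) (fun σ hσ => by
      obtain ⟨D, rfl⟩ := A.exists_chamberSign_of_mem_cells hσ
      rw [← graphMass_col A.topeGraph D]
      congr 1
      funext C
      rw [graphZetaMatrix, Matrix.of_apply, if_pos (A.topeGraph_reachable C D),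
        A.topeGraph_dist, opposite_eq_hammingDist (A.chamberSign_ne_zero C)
          (A.chamberSign_ne_zero D)])
  rw [graphMass_one, Fintype.card_coe, hn] at key
  -- A codimension 2 cell lies in at least two and at most n hyperplanes, so grouping by this number
  -- turns the sum over cells into the sum over k.
  have hmaps : ∀ σ ∈ cells A.form 2, (zeroSet σ).card ∈ Finset.Icc 2 n := fun σ hσ => by
    refine Finset.mem_Icc.2
      ⟨two_le_card_zeroSet A.form A.form_ne_zero ((mem_cells _).1 hσ).2, ?_⟩
    rw [← hn, ← Fintype.card_coe A.hyperplanes]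
    exact Finset.card_le_univ _
  rw [one_div, eq_inv_mul_iff_mul_eq₀ (RatFunc.one_add_X_pow_ne_zero n),
    HyperplaneArrangement.magnitude, key, A.ncard_chambers,
    ← Finset.sum_fiberwise_of_maps_to hmaps]
  congr 1
  refine Finset.sum_congr rfl fun k _ => ?_
  rw [A.numCodimTwo_eq, Finset.sum_congr rfl (g := fun _ => 2 * (k : RatFunc ℚ) * RatFunc.X *
    (1 - RatFunc.X ^ (k - 1)) / ((1 + RatFunc.X) * (1 - RatFunc.X ^ k)))
    (fun σ hσ => by rw [(Finset.mem_filter.1 hσ).2]), Finset.sum_const, nsmul_eq_mul]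
  ring
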